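/- **Setting.** A seller with private cost $c\sim G$ and a buyer with private value $v\sim F$ (independent, with densities $g$, $f$ supported on bounded intervals $[0,\bar c]$, $[0,\bar v]$) may trade one item through an intermediary. The seller distribution $G$ is *regular* if the virtual cost $\phi_{\mathcal S}(c)=c+\frac{G(c)}{g(c)}$ is non-decreasing on $[0,\bar c]$. The *optimal revenue* $\mathrm{OPT}(F,G)$ is the supremum of the intermediary's expected revenue $\mathbb E[p_{\mathcal B}-p_{\mathcal S}]$ over all direct mechanisms (trade decision in $\{0,1\}$, non-negative payments $p_{\mathcal B}$ charged to the buyer and $p_{\mathcal S}$ paid to the seller) that are Bayesian incentive compatible and interim individually rational. A *proper affine fee schedule* is $w(P)=(1-\alpha)P+\beta$ with $0\le\alpha\le 1$ and $\beta\ge 0$. Under it, the seller names a price $P\ge 0$; if $v\ge P$, the item is traded, the buyer pays $P$, the intermediary keeps $w(P)$ and the seller receives $P-w(P)$; if $v<P$, there is no trade and no payment. In equilibrium, the seller of each cost $c$ names a price $P(c)$ that maximizes $\mathbb E_v\big[(P-w(P)-c)\mathbf 1\{v\ge P\}\big]$ over $P\ge 0$, and the revenue is $\mathbb E_{c,v}\big[w(P(c))\mathbf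 1\{v\ge P(c)\}\big]$. Let $\mathrm{PROP}(F,G)$ be the supremum of this equilibrium revenue over all proper affine fee schedules, and let $RG_{F,G}=\mathrm{OPT}(F,G)/\mathrm{PROP}(F,G)$. **Theorem 3.** Let $F$ be the uniform distribution on $[0,1]$. For every constant $d$ there is a regular seller distribution $G$ such that both suprema are finite, $\mathrm{PROP}(F,G)>0$, and $RG_{F,G}\ge d$. Moreover, $G$ can be taken from the explicit family of distributions with densities $$g_\delta(x)=\frac{2\delta}{(1-\delta)(1-x)^3},\qquad x\in[0,1-\sqrt\delta],\qquad 0<\delta<1.$$ -/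

import Mathlib

open MeasureTheory ProbabilityTheory

noncomputable section

/-- A distribution of a private type (cost or value), given by a density whose support is a
bounded interval `[0, ub]`. -/
structure Prior where
  /-- right end point of the support -/
  ub : ℝ
  /-- probability density function -/
  pdf : ℝ → ℝ
  ub_pos : 0 < ub
  measurable_pdf : Measurable pdf
  pdf_pos : ∀ x ∈ Set.Icc 0 ub, 0 < pdf x
  pdf_zero : ∀ x, x ∉ Set.Icc 0 ub → pdf x = 0
  lintegral_pdf : ∫⁻ x, ENNReal.ofReal (pdf x) = 1

namespace Prior

/-- The probability measure with the given density. -/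
def law (D : Prior) : Measure ℝ := volume.withDensity fun x => ENNReal.ofReal (D.pdf x)

instance (D : Prior) : IsProbabilityMeasure D.law where
  measure_univ := by
    rw [law, withDensity_apply _ MeasurableSet.univ, Measure.restrict_univ]
    exact D.lintegral_pdf

/-- Type space `[0, ub]`. -/
def types (D : Prior) : Set ℝ := Set.Icc 0 D.ub

/-- Virtual cost `c + G(c) / g(c)` of a seller with prior `G`. -/
def virtualCost (G : Prior) (c : ℝ) : ℝ := c + cdf G.law c / G.pdf c

/-- The seller is regular: her virtual cost is non-decreasing on the support. -/
def SellerRegular (G : Prior) : Prop := MonotoneOn G.virtualCost G.types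

end Prior

/-- The uniform distribution on `[0, 1]`. -/
def uniform01 : Prior where
  ub := 1
  pdf := (Set.Icc (0 : ℝ) 1).indicator fun _ => 1
  ub_pos := one_pos
  measurable_pdf := measurable_const.indicator measurableSet_Icc
  pdf_pos := fun x hx => by rw [Set.indicator_of_mem hx]; exact one_pos
  pdf_zero := fun x hx => Set.indicator_of_notMem hx _
  lintegral_pdf := by
    have h : (fun x : ℝ => ENNReal.ofReal ((Set.Icc (0 : ℝ) 1).indicator (fun _ => (1 : ℝ)) x))
        = (Set.Icc (0 : ℝ) 1).indicator fun _ => 1 := by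
      funext x
      by_cases hx : x ∈ Set.Icc (0 : ℝ) 1 <;> simp [hx]
    rw [h, lintegral_indicator measurableSet_Icc]
    simp

/-! ### Direct mechanisms and the optimal revenue

Throughout, `F` is the prior of the buyer's value `v`, `G` is the prior of the seller's cost `c`,
and the two types are independent. -/

/-- A direct revelation exchange mechanism for one seller and one buyer: from the reported cost `c`
and the reported value `v` it decides whether the item is traded (`trade c v` is `1` or `0`), what
the buyer is charged and what the seller is paid. -/
structure DirectMechanism where
  trade : ℝ → ℝ → ℝ
  buyerPays : ℝ → ℝ → ℝ
  sellerGets : ℝ → ℝ → ℝ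
  trade_zero_or_one : ∀ c v, trade c v = 0 ∨ trade c v = 1
  buyerPays_nonneg : ∀ c v, 0 ≤ buyerPays c v
  sellerGets_nonneg : ∀ c v, 0 ≤ sellerGets c v
  measurable_trade : Measurable (Function.uncurry trade)
  measurable_buyerPays : Measurable (Function.uncurry buyerPays)
  measurable_sellerGets : Measurable (Function.uncurry sellerGets)

namespace DirectMechanism

/-- All the expectations of payments, ex ante and interim, are finite. -/
def FinitePayments (M : DirectMechanism) (F G : Prior) : Prop :=
  Integrable (Function.uncurry M.buyerPays) (G.law.prod F.law) ∧
  Integrable (Function.uncurry M.sellerGets) (G.law.prod F.law) ∧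
  (∀ v ∈ F.types, Integrable (fun c => M.buyerPays c v) G.law) ∧
  (∀ c ∈ G.types, Integrable (fun v => M.sellerGets c v) F.law)

/-- Interim expected utility of a buyer of value `v` who reports `v'` when the seller is
truthful. -/
def buyerUtility (M : DirectMechanism) (G : Prior) (v v' : ℝ) : ℝ :=
  ∫ c, (v * M.trade c v' - M.buyerPays c v') ∂G.law

/-- Interim expected utility of a seller of cost `c` who reports `c'` when the buyer is truthful. -/
def sellerUtility (M : DirectMechanism) (F : Prior) (c c' : ℝ) : ℝ :=
  ∫ v, (M.sellerGets c' v - c * M.trade c' v) ∂F.law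

/-- Bayesian incentive compatibility: truthful reporting is a Bayes-Nash equilibrium. -/
def BIC (M : DirectMechanism) (F G : Prior) : Prop :=
  (∀ v ∈ F.types, ∀ v' ∈ F.types, M.buyerUtility G v v' ≤ M.buyerUtility G v v) ∧
  (∀ c ∈ G.types, ∀ c' ∈ G.types, M.sellerUtility F c c' ≤ M.sellerUtility F c c)

/-- Interim individual rationality. -/
def InterimIR (M : DirectMechanism) (F G : Prior) : Prop :=
  (∀ v ∈ F.types, 0 ≤ M.buyerUtility G v v) ∧ (∀ c ∈ G.types, 0 ≤ M.sellerUtility F c c)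

/-- Expected revenue of the intermediary under truthful reports. -/
def revenue (M : DirectMechanism) (F G : Prior) : ℝ :=
  ∫ z, (M.buyerPays z.1 z.2 - M.sellerGets z.1 z.2) ∂(G.law.prod F.law)

end DirectMechanism

/-- Expected revenues of the BIC and interim IR direct mechanisms. -/
def mechanismRevenues (F G : Prior) : Set ℝ :=
  {r | ∃ M : DirectMechanism,
    M.FinitePayments F G ∧ M.BIC F G ∧ M.InterimIR F G ∧ r = M.revenue F G}

/-- Optimal revenue of the intermediary. -/
def optRevenue (F G : Prior) : ℝ := sSup (mechanismRevenues F G)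

/-! ### Fee-setting mechanisms

The seller names a price `p`; the buyer takes the item at this price if and only if `p ≤ v`; if the
item is traded, the intermediary keeps `w p` and the seller receives `p - w p`; otherwise no money
changes hands. -/

/-- Expected utility of a seller of cost `c` who names the price `p` under fee schedule `w`. -/
def feeSellerUtility (F : Prior) (w : ℝ → ℝ) (c p : ℝ) : ℝ :=
  open Classical in ∫ v, (if p ≤ v then p - w p - c else 0) ∂F.law

/-- `P` is an equilibrium pricing strategy of the seller: each cost type names a price that
maximizes her expected utility among all nonnegative prices. -/
def IsFeeEquilibrium (F G : Prior) (w P : ℝ → ℝ) : Prop :=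
  Measurable P ∧ ∀ c ∈ G.types,
    0 ≤ P c ∧ ∀ p, 0 ≤ p → feeSellerUtility F w c p ≤ feeSellerUtility F w c (P c)

/-- Expected revenue of the fee schedule `w` when the seller plays the strategy `P`. -/
def feeRevenue (F G : Prior) (w P : ℝ → ℝ) : ℝ :=
  open Classical in ∫ c, ∫ v, (if P c ≤ v then w (P c) else 0) ∂F.law ∂G.law

/-- The affine fee schedule with parameters `α` and `β`. -/
def affineFee (α β : ℝ) : ℝ → ℝ := fun p => (1 - α) * p + β

/-- Equilibrium revenues of the proper affine fee schedules. -/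
def properRevenues (F G : Prior) : Set ℝ :=
  {r | ∃ α β : ℝ, ∃ P : ℝ → ℝ, 0 ≤ α ∧ α ≤ 1 ∧ 0 ≤ β ∧
    IsFeeEquilibrium F G (affineFee α β) P ∧ r = feeRevenue F G (affineFee α β) P}

/-- Revenue of the best proper affine fee schedule. -/
def bestProperRevenue (F G : Prior) : ℝ := sSup (properRevenues F G)

/-- Ratio of the optimal revenue to the revenue of the best proper affine fee schedule. -/
def revenueGap (F G : Prior) : ℝ := optRevenue F G / bestProperRevenue F G

end

/-! Put `s = √δ`: the seller's density is proportional to `(1 - x)⁻³` on `[0, 1 - s]`, and the two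
revenues are separated by a factor of order `-log s`.

Optimal side: the buyer's virtual value is `2 v - 1`, the seller's virtual cost is `(1 + c) / 2 - (1
- c) ^ 3 / 2`. Dropping the cubic term from Myerson's comparison of the two leaves the rule "trade
iff `c ≤ 4 v - 3`". At threshold prices it is incentive compatible and earns `(1 - c) ^ 2 / 16` from
cost `c`; against the density this integrates a multiple of `1 / (1 - x)`, whence the logarithm in
`le_optRevenue_cubicPrior`.

Fee side: a seller who trades with positive probability names the midpoint of `1` and her break-even
price `(β + c) / α`. With `t = α - β`, the fee is then at most `1 - t` and the probability of trade
at most `(t - c) / (2 t)`. Since `max (t - c) 0` has mean at most `s ^ 2 / (1 - s ^ 2) * (t ^ 2 / (1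
- t))`, the factor `1 - t` cancels and every schedule earns at most `s ^ 2 / (2 * (1 - s ^ 2))`
(`feeRevenue_cubicPrior_le`). The ratio is therefore at least `-log s / 4`. -/

noncomputable section

/-! ### Expectations under a prior with a density. -/

namespace Prior

theorem law_eq_restrict (D : Prior) :
    D.law = (volume.restrict (Set.Icc 0 D.ub)).withDensity fun x => ENNReal.ofReal (D.pdf x) := by
  rw [law, ← withDensity_indicator measurableSet_Icc]
  congr 1
  funext x
  by_cases hx : x ∈ Set.Icc 0 D.ub
  · rw [Set.indicator_of_mem hx]
  · rw [Set.indicator_of_notMem hx, D.pdf_zero x hx, ENNReal.ofReal_zero]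

theorem law_absolutelyContinuous (D : Prior) : D.law ≪ volume :=
  withDensity_absolutelyContinuous _ _

theorem ae_mem_types (D : Prior) : ∀ᵐ x ∂D.law, x ∈ D.types := by
  rw [law_eq_restrict]
  exact (withDensity_absolutelyContinuous _ _).ae_le (ae_restrict_mem measurableSet_Icc)

theorem ae_ne (D : Prior) (a : ℝ) : ∀ᵐ x ∂D.law, x ≠ a :=
  D.law_absolutelyContinuous.ae_le (Measure.ae_ne volume a)

theorem pdf_nonneg (D : Prior) (x : ℝ) : 0 ≤ D.pdf x := by
  by_cases hx : x ∈ Set.Icc 0 D.ub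
  · exact (D.pdf_pos x hx).le
  · exact (D.pdf_zero x hx).ge

theorem integrable_pdf (D : Prior) : Integrable D.pdf := by
  refine ⟨D.measurable_pdf.aestronglyMeasurable, ?_⟩
  rw [hasFiniteIntegral_iff_ofReal (.of_forall D.pdf_nonneg), D.lintegral_pdf]
  exact ENNReal.one_lt_top

/-- Expectations are interval integrals against the density. -/
theorem integral_law (D : Prior) (h : ℝ → ℝ) :
    ∫ x, h x ∂D.law = ∫ x in (0 : ℝ)..D.ub, D.pdf x * h x := by
  rw [law_eq_restrict, integral_withDensity_eq_integral_toReal_smul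
    D.measurable_pdf.ennreal_ofReal (by simp), intervalIntegral.integral_of_le D.ub_pos.le,
    integral_Icc_eq_integral_Ioc]
  simp [ENNReal.toReal_ofReal (D.pdf_nonneg _)]

end Prior

/-- A measurable function with values in `[-1, 1]` is integrable for a finite measure. -/
theorem integrable_of_abs_le_one {Ω : Type*} [MeasurableSpace Ω] {μ : Measure Ω}
    [IsFiniteMeasure μ] {h : Ω → ℝ} (hm : Measurable h) (hb : ∀ x, |h x| ≤ 1) : Integrable h μ :=
  Integrable.of_bound hm.aestronglyMeasurable 1 (.of_forall hb)

/-! ### A uniform buyer facing a named price. -/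

theorem uniform01_law : uniform01.law = volume.restrict (Set.Icc 0 1) := by
  rw [Prior.law_eq_restrict]
  change (volume.restrict (Set.Icc (0 : ℝ) 1)).withDensity
    (fun x => ENNReal.ofReal ((Set.Icc (0 : ℝ) 1).indicator (fun _ => (1 : ℝ)) x)) = _
  conv_rhs => rw [← withDensity_one (μ := volume.restrict (Set.Icc (0 : ℝ) 1))]
  refine withDensity_congr_ae ?_
  filter_upwards [ae_restrict_mem measurableSet_Icc] with x hx
  simp [Set.indicator_of_mem hx]

/-- Expectation over the uniform values of at least `a ≥ 0`. -/
theorem integral_uniform01_indicator_Ici (h : ℝ → ℝ) {a : ℝ} (ha : 0 ≤ a) :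
    ∫ v, (Set.Ici a).indicator h v ∂uniform01.law = ∫ v in Set.Icc a 1, h v := by
  rw [integral_indicator measurableSet_Ici, uniform01_law,
    Measure.restrict_restrict measurableSet_Ici]
  congr 2
  ext x
  simp only [Set.mem_inter_iff, Set.mem_Ici, Set.mem_Icc]
  constructor
  · rintro ⟨h1, -, h2⟩
    exact ⟨h1, h2⟩
  · rintro ⟨h1, h2⟩
    exact ⟨h1, ha.trans h1, h2⟩

open Classical in
theorem integral_uniform01_ite (K : ℝ) {p : ℝ} (hp : 0 ≤ p) :
    ∫ v, (if p ≤ v then K else 0) ∂uniform01.law = K * max (1 - p) 0 := by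
  have h := integral_uniform01_indicator_Ici (fun _ => K) hp
  simp only [Set.indicator_apply, Set.mem_Ici] at h
  have h' : ∫ v, (if p ≤ v then K else 0) ∂uniform01.law = ∫ _ in Set.Icc p 1, K := by
    rw [← h]
  rw [h', setIntegral_const, smul_eq_mul, measureReal_def, Real.volume_Icc, mul_comm,
    ENNReal.toReal_ofReal']

theorem feeSellerUtility_uniform01 (w : ℝ → ℝ) (c : ℝ) {p : ℝ} (hp : 0 ≤ p) :
    feeSellerUtility uniform01 w c p = (p - w p - c) * max (1 - p) 0 :=
  integral_uniform01_ite _ hp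

theorem feeRevenue_uniform01 {G : Prior} (w : ℝ → ℝ) {P : ℝ → ℝ}
    (hP : ∀ c ∈ G.types, 0 ≤ P c) :
    feeRevenue uniform01 G w P = ∫ c, w (P c) * max (1 - P c) 0 ∂G.law := by
  refine integral_congr_ae ?_
  filter_upwards [G.ae_mem_types] with c hc
  exact integral_uniform01_ite _ (hP c hc)

/-- With a uniform buyer and an affine fee, a price that is optimal for a seller of positive cost
`c` brings the intermediary little revenue. -/
theorem affineFee_revenue_le {α β c p : ℝ} (hα : 0 ≤ α) (hα1 : α ≤ 1) (hβ : 0 ≤ β)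
    (hc : 0 < c) (hp : 0 ≤ p)
    (hopt : ∀ q, 0 ≤ q → (q - affineFee α β q - c) * max (1 - q) 0
      ≤ (p - affineFee α β p - c) * max (1 - p) 0) :
    affineFee α β p * max (1 - p) 0
      ≤ (1 - (α - β)) * max (α - β - c) 0 / (2 * (α - β)) ∨
    affineFee α β p * max (1 - p) 0 = 0 := by
  -- A price of at least `1` sells with probability zero.
  rcases le_or_gt 1 p with h1 | h1
  · right
    rw [max_eq_right (by linarith), mul_zero]
  left
  unfold affineFee at *
  have hmp : max (1 - p) 0 = 1 - p := max_eq_left (by linarith)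
  rw [hmp] at hopt ⊢
  -- The price `1` guarantees utility zero, so the margin at the optimal `p < 1` is nonnegative.
  have hs : 0 ≤ α * p - β - c := by
    have h := hopt 1 zero_le_one
    simp only [sub_self, max_self, mul_zero] at h
    have := nonneg_of_mul_nonneg_left h (by linarith)
    linarith
  -- If `α = 0`, the margin is `-β - c < 0`. This is where `0 < c` matters: with `α = β = c = 0`
  -- every price is optimal.
  have hα0 : 0 < α := by
    rcases hα.eq_or_lt with h | h
    · subst h
      linarith
    · exact h
  have ht : 0 < α - β - c := by nlinarith
  -- `x` is the break-even price; utility is `α * (q - x) * (1 - q)` for `q ≤ 1`, with vertex `(1 +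
  -- x) / 2`.
  obtain ⟨x, hx⟩ : ∃ x, x = (β + c) / α := ⟨_, rfl⟩
  have hxα : α * x = β + c := by rw [hx]; field_simp
  have hx0 : 0 ≤ x := by rw [hx]; positivity
  have hx1 : x < 1 := by
    rw [hx, div_lt_one hα0]; linarith
  have hpx : p = (1 + x) / 2 := by
    have h := hopt ((1 + x) / 2) (by linarith)
    rw [max_eq_left (by linarith)] at h
    have h2 : α * (p - (1 + x) / 2) ^ 2 ≤ 0 := by
      have e : α * (p - (1 + x) / 2) ^ 2
          = (α * ((1 + x) / 2) - α * x) * (1 - (1 + x) / 2) - (α * p - α * x) * (1 - p) := by ring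
      rw [e, hxα]
      linarith
    have h3 : (p - (1 + x) / 2) ^ 2 ≤ 0 := nonpos_of_mul_nonpos_right h2 hα0
    have h4 : p - (1 + x) / 2 = 0 := pow_eq_zero_iff (two_ne_zero) |>.1 (le_antisymm h3 (sq_nonneg _))
    linarith
  -- The fee is nondecreasing in the price, and `1 - (α - β)` is its value at price `1`.
  have hw : (1 - α) * p + β ≤ 1 - (α - β) := by nlinarith
  have hw0 : 0 ≤ 1 - (α - β) := by linarith
  have h1p : 1 - p = (α - β - c) / (2 * α) := by
    rw [hpx, eq_div_iff (by positivity)]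
    linarith
  have h1p' : 1 - p ≤ (α - β - c) / (2 * (α - β)) := by
    rw [h1p]
    exact div_le_div_of_nonneg_left ht.le (by linarith) (by linarith)
  rw [max_eq_left ht.le, mul_div_assoc]
  exact mul_le_mul hw h1p' (by linarith) hw0

/-! ### The cubic seller distribution: integrals, normalization, regularity. -/

/-- The density proportional to `(1 - x)⁻³` on `[0, 1 - s]`. -/
def cubicDensity (s x : ℝ) : ℝ := 2 * s ^ 2 / ((1 - s ^ 2) * (1 - x) ^ 3)

theorem cubicDensity_pos {s x : ℝ} (hs : 0 < s) (hs1 : s < 1) (hx : x < 1) :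
    0 < cubicDensity s x := by
  have h1 : 0 < 1 - s ^ 2 := by nlinarith
  have h2 : 0 < 1 - x := by linarith
  unfold cubicDensity
  positivity

theorem continuousOn_cubicDensity {s : ℝ} (hs : 0 < s) (hs1 : s < 1) :
    ContinuousOn (cubicDensity s) (Set.Iio 1) := by
  have h1 : 0 < 1 - s ^ 2 := by nlinarith
  refine ContinuousOn.div (by fun_prop) (by fun_prop) fun x hx => ?_
  have h2 : 0 < 1 - x := by linarith [Set.mem_Iio.1 hx]
  positivity

theorem hasDerivAt_inv_one_sub {x : ℝ} (hx : x < 1) :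
    HasDerivAt (fun x : ℝ => (1 - x)⁻¹) (1 / (1 - x) ^ 2) x := by
  have h2 : (1 - x) ≠ 0 := by linarith
  refine (((hasDerivAt_id x).const_sub 1).inv h2).congr_deriv ?_
  simp

theorem hasDerivAt_inv_one_sub_sq {x : ℝ} (hx : x < 1) :
    HasDerivAt (fun x : ℝ => (1 - x)⁻¹ ^ 2) (2 / (1 - x) ^ 3) x := by
  have h2 : (1 - x) ≠ 0 := by linarith
  refine ((hasDerivAt_inv_one_sub hx).pow 2).congr_deriv ?_
  norm_num
  field_simp

theorem uIcc_subset_Iio_one {a : ℝ} (ha0 : 0 ≤ a) (ha : a < 1) :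
    Set.uIcc 0 a ⊆ Set.Iio 1 := by
  rw [Set.uIcc_of_le ha0]
  exact fun x hx => hx.2.trans_lt ha

theorem integral_cubicDensity {s a : ℝ} (hs : 0 < s) (hs1 : s < 1) (ha0 : 0 ≤ a) (ha : a < 1) :
    ∫ x in (0 : ℝ)..a, cubicDensity s x = s ^ 2 / (1 - s ^ 2) * ((1 - a)⁻¹ ^ 2 - 1) := by
  have hI := uIcc_subset_Iio_one ha0 ha
  rw [intervalIntegral.integral_eq_sub_of_hasDerivAt
    (f := fun x => s ^ 2 / (1 - s ^ 2) * (1 - x)⁻¹ ^ 2)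
    (fun x hx => ?_) ((continuousOn_cubicDensity hs hs1).mono hI).intervalIntegrable]
  · simp
    ring
  · refine ((hasDerivAt_inv_one_sub_sq (hI hx)).const_mul (s ^ 2 / (1 - s ^ 2))).congr_deriv ?_
    unfold cubicDensity
    rw [div_mul_div_comm]
    ring

/-- Writing `a - x = (1 - x) - (1 - a)` splits the integrand into multiples of `(1 - x)⁻²` and `(1 -
x)⁻³`. -/
theorem integral_cubicDensity_mul_sub {s a : ℝ} (hs : 0 < s) (hs1 : s < 1) (ha0 : 0 ≤ a)
    (ha : a < 1) :
    ∫ x in (0 : ℝ)..a, cubicDensity s x * (a - x)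
      = s ^ 2 / (1 - s ^ 2) * (a ^ 2 / (1 - a)) := by
  have hI := uIcc_subset_Iio_one ha0 ha
  have h1a : 1 - a ≠ 0 := by linarith
  have hint : IntervalIntegrable (fun x => cubicDensity s x * (a - x)) volume 0 a :=
    (((continuousOn_cubicDensity hs hs1).mono hI).mul (by fun_prop)).intervalIntegrable
  rw [intervalIntegral.integral_eq_sub_of_hasDerivAt
    (f := fun x => s ^ 2 / (1 - s ^ 2) * (2 * (1 - x)⁻¹ - (1 - a) * (1 - x)⁻¹ ^ 2))
    (fun x hx => ?_) hint]
  · rw [← mul_sub]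
    congr 1
    field_simp
    ring
  · have hx1 : x < 1 := hI hx
    have h2 : 1 - x ≠ 0 := by linarith
    have h3 : 1 - s ^ 2 ≠ 0 := by nlinarith
    refine ((((hasDerivAt_inv_one_sub hx1).const_mul 2).sub
      ((hasDerivAt_inv_one_sub_sq hx1).const_mul (1 - a))).const_mul
        (s ^ 2 / (1 - s ^ 2))).congr_deriv ?_
    unfold cubicDensity
    field_simp
    ring

theorem integral_cubicDensity_mul_sq {s : ℝ} (hs : 0 < s) (hs1 : s < 1) :
    ∫ x in (0 : ℝ)..(1 - s), cubicDensity s x * ((1 - x) ^ 2 / 16)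
      = s ^ 2 / (1 - s ^ 2) * (-Real.log s / 8) := by
  have hI := uIcc_subset_Iio_one (a := 1 - s) (by linarith) (by linarith)
  have hint : IntervalIntegrable (fun x => cubicDensity s x * ((1 - x) ^ 2 / 16)) volume
      0 (1 - s) :=
    (((continuousOn_cubicDensity hs hs1).mono hI).mul (by fun_prop)).intervalIntegrable
  rw [intervalIntegral.integral_eq_sub_of_hasDerivAt
    (f := fun x => s ^ 2 / (1 - s ^ 2) * (-Real.log (1 - x) / 8))
    (fun x hx => ?_) hint]
  · simp
  · have hx1 : x < 1 := hI hx
    have h2 : 1 - x ≠ 0 := by linarith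
    have h3 : 1 - s ^ 2 ≠ 0 := by nlinarith
    refine (((((hasDerivAt_id x).const_sub 1).log h2).neg.div_const 8).const_mul
      (s ^ 2 / (1 - s ^ 2))).congr_deriv ?_
    unfold cubicDensity
    simp only [id]
    field_simp
    ring

theorem setLIntegral_cubicDensity {s a : ℝ} (hs : 0 < s) (hs1 : s < 1) (ha0 : 0 ≤ a)
    (ha : a < 1) :
    ∫⁻ x in Set.Icc 0 a, ENNReal.ofReal (cubicDensity s x)
      = ENNReal.ofReal (s ^ 2 / (1 - s ^ 2) * ((1 - a)⁻¹ ^ 2 - 1)) := by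
  have hI := uIcc_subset_Iio_one ha0 ha
  rw [Set.uIcc_of_le ha0] at hI
  rw [← integral_cubicDensity hs hs1 ha0 ha, intervalIntegral.integral_of_le ha0,
    ← integral_Icc_eq_integral_Ioc, ofReal_integral_eq_lintegral_ofReal]
  · exact ((continuousOn_cubicDensity hs hs1).mono hI).integrableOn_Icc
  · filter_upwards [ae_restrict_mem measurableSet_Icc] with x hx
    exact (cubicDensity_pos hs hs1 (hI hx)).le

/-- The prior with density proportional to `(1 - x)⁻³` on `[0, 1 - s]`. -/
def cubicPrior (s : ℝ) (hs : 0 < s) (hs1 : s < 1) : Prior where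
  ub := 1 - s
  pdf := (Set.Icc 0 (1 - s)).indicator (cubicDensity s)
  ub_pos := by linarith
  measurable_pdf := by
    refine Measurable.indicator ?_ measurableSet_Icc
    unfold cubicDensity
    fun_prop
  pdf_pos := fun x hx => by
    rw [Set.indicator_of_mem hx]
    exact cubicDensity_pos hs hs1 (by linarith [hx.2])
  pdf_zero := fun x hx => Set.indicator_of_notMem hx _
  lintegral_pdf := by
    have h : (fun x : ℝ => ENNReal.ofReal ((Set.Icc 0 (1 - s)).indicator (cubicDensity s) x))
        = (Set.Icc 0 (1 - s)).indicator fun x => ENNReal.ofReal (cubicDensity s x) := by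
      funext x
      by_cases hx : x ∈ Set.Icc 0 (1 - s)
      · simp only [Set.indicator_of_mem hx]
      · simp only [Set.indicator_of_notMem hx, ENNReal.ofReal_zero]
    have h3 : 1 - s ^ 2 ≠ 0 := by nlinarith
    rw [h, lintegral_indicator measurableSet_Icc,
      setLIntegral_cubicDensity hs hs1 (by linarith) (by linarith), ← ENNReal.ofReal_one]
    congr 1
    rw [sub_sub_cancel]
    field_simp

section cubicPrior

variable {s : ℝ} (hs : 0 < s) (hs1 : s < 1)

theorem cubicPrior_pdf {x : ℝ} (hx : x ∈ Set.Icc 0 (1 - s)) :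
    (cubicPrior s hs hs1).pdf x = cubicDensity s x :=
  Set.indicator_of_mem hx _

theorem integral_cubicPrior (h : ℝ → ℝ) :
    ∫ x, h x ∂(cubicPrior s hs hs1).law
      = ∫ x in (0 : ℝ)..(1 - s), cubicDensity s x * h x := by
  rw [Prior.integral_law]
  refine intervalIntegral.integral_congr fun x hx => ?_
  change x ∈ Set.uIcc 0 (1 - s) at hx
  rw [Set.uIcc_of_le (by linarith)] at hx
  simp only [cubicPrior_pdf hs hs1 hx]

theorem cdf_cubicPrior {c : ℝ} (hc : c ∈ Set.Icc 0 (1 - s)) :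
    cdf (cubicPrior s hs hs1).law c = s ^ 2 / (1 - s ^ 2) * ((1 - c)⁻¹ ^ 2 - 1) := by
  have hc1 : c < 1 := by linarith [hc.2]
  have h3 : 0 < 1 - s ^ 2 := by nlinarith
  have h4 : 1 ≤ (1 - c)⁻¹ := (one_le_inv₀ (by linarith)).2 (by linarith [hc.1])
  rw [cdf_eq_real, measureReal_def, Prior.law_eq_restrict,
    withDensity_apply _ measurableSet_Iic, Measure.restrict_restrict measurableSet_Iic]
  have hset : Set.Iic c ∩ Set.Icc 0 (cubicPrior s hs hs1).ub = Set.Icc 0 c := by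
    change Set.Iic c ∩ Set.Icc 0 (1 - s) = _
    ext x
    simp only [Set.mem_inter_iff, Set.mem_Iic, Set.mem_Icc]
    exact ⟨fun h => ⟨h.2.1, h.1⟩, fun h => ⟨h.2, h.1, h.2.trans hc.2⟩⟩
  rw [hset, setLIntegral_congr_fun (g := fun x => ENNReal.ofReal (cubicDensity s x))
    measurableSet_Icc, setLIntegral_cubicDensity hs hs1 hc.1 hc1, ENNReal.toReal_ofReal]
  · have : 1 ≤ (1 - c)⁻¹ ^ 2 := one_le_pow₀ h4
    have : 0 ≤ (1 - c)⁻¹ ^ 2 - 1 := by linarith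
    positivity
  · intro x hx
    simp only [cubicPrior_pdf hs hs1 ⟨hx.1, hx.2.trans hc.2⟩]

/-- The normalizing constant cancels in the quotient, so `s` affects only the support. -/
theorem virtualCost_cubicPrior {c : ℝ} (hc : c ∈ Set.Icc 0 (1 - s)) :
    (cubicPrior s hs hs1).virtualCost c = c + ((1 - c) - (1 - c) ^ 3) / 2 := by
  have h2 : 1 - c ≠ 0 := by linarith [hc.2]
  have h3 : 1 - s ^ 2 ≠ 0 := by nlinarith
  rw [Prior.virtualCost, cdf_cubicPrior hs hs1 hc, cubicPrior_pdf hs hs1 hc, cubicDensity]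
  field_simp

theorem sellerRegular_cubicPrior : (cubicPrior s hs hs1).SellerRegular := by
  intro a ha b hb hab
  have ha' : a ∈ Set.Icc 0 (1 - s) := ha
  have hb' : b ∈ Set.Icc 0 (1 - s) := hb
  rw [virtualCost_cubicPrior hs hs1 ha', virtualCost_cubicPrior hs hs1 hb']
  have h : (1 - b) ^ 3 ≤ (1 - a) ^ 3 :=
    pow_le_pow_left₀ (by linarith [hb'.2]) (by linarith) 3
  linarith

end cubicPrior

/-! ### Finiteness of the optimal revenue. -/

namespace DirectMechanism

/-- No individually rational mechanism extracts more than the largest value of the buyer. -/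
theorem revenue_uniform01_le_one {G : Prior} {M : DirectMechanism}
    (hfin : M.FinitePayments uniform01 G) (hIR : M.InterimIR uniform01 G) :
    M.revenue uniform01 G ≤ 1 := by
  obtain ⟨hB, hS, hBv, -⟩ := hfin
  have hS0 : 0 ≤ ∫ z, M.sellerGets z.1 z.2 ∂(G.law.prod uniform01.law) :=
    integral_nonneg fun z => M.sellerGets_nonneg _ _
  have hB1 : ∫ z, M.buyerPays z.1 z.2 ∂(G.law.prod uniform01.law) ≤ 1 := by
    have hF := integral_prod_symm (Function.uncurry M.buyerPays) hB
    change ∫ z, M.buyerPays z.1 z.2 ∂(G.law.prod uniform01.law) = _ at hF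
    rw [hF]
    have hle : ∀ᵐ v ∂uniform01.law, ∫ c, M.buyerPays c v ∂G.law ≤ 1 := by
      filter_upwards [uniform01.ae_mem_types] with v hv
      have htr : Integrable (fun c => M.trade c v) G.law :=
        integrable_of_abs_le_one (M.measurable_trade.comp measurable_prodMk_right) fun c => by
          rcases M.trade_zero_or_one c v with h | h <;> simp [h]
      -- Individual rationality bounds the interim payment by `v` times the probability of trade,
      -- hence by `1`.
      have h0 := hIR.1 v hv
      rw [buyerUtility, integral_sub (htr.const_mul v) (hBv v hv)] at h0
      have h1 : ∫ c, v * M.trade c v ∂G.law ≤ ∫ _, (1 : ℝ) ∂G.law := by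
        refine integral_mono (htr.const_mul v) (integrable_const 1) fun c => ?_
        have hv1 : v ≤ 1 := hv.2
        rcases M.trade_zero_or_one c v with h | h <;> simp [h, hv1]
      rw [integral_const, probReal_univ, one_smul] at h1
      linarith
    calc ∫ v, ∫ c, M.buyerPays c v ∂G.law ∂uniform01.law ≤ ∫ _, (1 : ℝ) ∂uniform01.law :=
          integral_mono_ae hB.integral_prod_right (integrable_const 1) hle
      _ = 1 := by rw [integral_const, probReal_univ, one_smul]
  have hsub : M.revenue uniform01 G = ∫ z, M.buyerPays z.1 z.2 ∂(G.law.prod uniform01.law)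
      - ∫ z, M.sellerGets z.1 z.2 ∂(G.law.prod uniform01.law) := integral_sub hB hS
  linarith

end DirectMechanism

theorem bddAbove_mechanismRevenues_uniform01 (G : Prior) :
    BddAbove (mechanismRevenues uniform01 G) := by
  refine ⟨1, ?_⟩
  rintro r ⟨M, hfin, -, hIR, rfl⟩
  exact M.revenue_uniform01_le_one hfin hIR

/-! ### A lower bound on the optimal revenue: the threshold mechanism. -/

/-- Reports `(c, v)` with `0 ≤ c ≤ 4 v - 3` and `v ≤ 1`. -/
def thresholdRegion : Set (ℝ × ℝ) := {z | 0 ≤ z.1 ∧ z.2 ≤ 1 ∧ z.1 ≤ 4 * z.2 - 3}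

theorem mem_thresholdRegion {c v : ℝ} :
    (c, v) ∈ thresholdRegion ↔ 0 ≤ c ∧ v ≤ 1 ∧ c ≤ 4 * v - 3 := Iff.rfl

theorem measurableSet_thresholdRegion : MeasurableSet thresholdRegion :=
  (measurableSet_le measurable_const measurable_fst).inter
    ((measurableSet_le measurable_snd measurable_const).inter
      (measurableSet_le measurable_fst (by fun_prop)))

open Classical in
/-- The mechanism that trades if and only if `c ≤ 4 v - 3`, at the threshold prices. -/
def thresholdMechanism : DirectMechanism where
  trade c v := if (c, v) ∈ thresholdRegion then 1 else 0
  -- The buyer pays the lowest value that still trades against `c`; the seller gets the highest cost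
  -- that still trades against `v`.
  buyerPays c v := if (c, v) ∈ thresholdRegion then (3 + c) / 4 else 0
  sellerGets c v := if (c, v) ∈ thresholdRegion then 4 * v - 3 else 0
  trade_zero_or_one c v := by
    by_cases h : (c, v) ∈ thresholdRegion <;> simp [h]
  buyerPays_nonneg c v := by
    split_ifs with h
    · have := h.1
      change 0 ≤ c at this
      linarith
    · exact le_rfl
  sellerGets_nonneg c v := by
    split_ifs with h
    · exact h.1.trans h.2.2
    · exact le_rfl
  measurable_trade :=
    Measurable.ite measurableSet_thresholdRegion measurable_const measurable_const
  measurable_buyerPays :=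
    Measurable.ite measurableSet_thresholdRegion (by fun_prop) measurable_const
  measurable_sellerGets :=
    Measurable.ite measurableSet_thresholdRegion (by fun_prop) measurable_const

namespace thresholdMechanism

theorem abs_trade_le (c v : ℝ) : |thresholdMechanism.trade c v| ≤ 1 := by
  rcases thresholdMechanism.trade_zero_or_one c v with h | h <;> simp [h]

theorem abs_buyerPays_le (c v : ℝ) : |thresholdMechanism.buyerPays c v| ≤ 1 := by
  rw [abs_of_nonneg (thresholdMechanism.buyerPays_nonneg c v)]
  simp only [thresholdMechanism]
  split_ifs with h
  · obtain ⟨-, h2, h3⟩ := h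
    simp only at h2 h3
    linarith
  · exact zero_le_one

theorem abs_sellerGets_le (c v : ℝ) : |thresholdMechanism.sellerGets c v| ≤ 1 := by
  rw [abs_of_nonneg (thresholdMechanism.sellerGets_nonneg c v)]
  simp only [thresholdMechanism]
  split_ifs with h
  · obtain ⟨-, h2, h3⟩ := h
    simp only at h2 h3
    linarith
  · exact zero_le_one

variable {F G : Prior}

theorem integrable_buyerUtility (v v' : ℝ) : Integrable
    (fun c => v * thresholdMechanism.trade c v' - thresholdMechanism.buyerPays c v') G.law :=
  ((integrable_of_abs_le_one
    (thresholdMechanism.measurable_trade.comp measurable_prodMk_right)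
    fun c => abs_trade_le c v').const_mul v).sub
  (integrable_of_abs_le_one
    (thresholdMechanism.measurable_buyerPays.comp measurable_prodMk_right)
    fun c => abs_buyerPays_le c v')

theorem integrable_sellerUtility (c c' : ℝ) : Integrable
    (fun v => thresholdMechanism.sellerGets c' v - c * thresholdMechanism.trade c' v) F.law :=
  (integrable_of_abs_le_one
    (thresholdMechanism.measurable_sellerGets.comp measurable_prodMk_left)
    fun v => abs_sellerGets_le c' v).sub
  ((integrable_of_abs_le_one
    (thresholdMechanism.measurable_trade.comp measurable_prodMk_left)
    fun v => abs_trade_le c' v).const_mul c)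

theorem finitePayments : thresholdMechanism.FinitePayments F G :=
  ⟨integrable_of_abs_le_one thresholdMechanism.measurable_buyerPays
      fun z => abs_buyerPays_le z.1 z.2,
    integrable_of_abs_le_one thresholdMechanism.measurable_sellerGets
      fun z => abs_sellerGets_le z.1 z.2,
    fun v _ => integrable_of_abs_le_one
      (thresholdMechanism.measurable_buyerPays.comp measurable_prodMk_right)
      fun c => abs_buyerPays_le c v,
    fun c _ => integrable_of_abs_le_one
      (thresholdMechanism.measurable_sellerGets.comp measurable_prodMk_left)
      fun v => abs_sellerGets_le c v⟩

/-- Threshold prices make truth optimal against each realized report of the other side, so the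
inequality holds pointwise under the integral. -/
theorem bic (hF : F.ub ≤ 1) : thresholdMechanism.BIC F G := by
  constructor
  · intro v hv v' hv'
    refine integral_mono (integrable_buyerUtility v v') (integrable_buyerUtility v v) fun c => ?_
    have h1 : v ≤ 1 := hv.2.trans hF
    simp only [thresholdMechanism, mem_thresholdRegion]
    split_ifs with h h' h' <;> grind
  · intro c hc c' hc'
    refine integral_mono (integrable_sellerUtility c c') (integrable_sellerUtility c c) fun v => ?_
    have h1 : 0 ≤ c := hc.1
    simp only [thresholdMechanism, mem_thresholdRegion]
    split_ifs with h h' h' <;> grind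

theorem interimIR : thresholdMechanism.InterimIR F G := by
  constructor
  · intro v _
    refine integral_nonneg fun c => ?_
    simp only [thresholdMechanism, mem_thresholdRegion, Pi.zero_apply]
    split_ifs with h <;> grind
  · intro c _
    refine integral_nonneg fun v => ?_
    simp only [thresholdMechanism, mem_thresholdRegion, Pi.zero_apply]
    split_ifs with h <;> grind

theorem integral_revenue {c : ℝ} (hc0 : 0 ≤ c) (hc1 : c ≤ 1) :
    ∫ v, (thresholdMechanism.buyerPays c v - thresholdMechanism.sellerGets c v) ∂uniform01.law
      = (1 - c) ^ 2 / 16 := by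
  have hae : (fun v => thresholdMechanism.buyerPays c v - thresholdMechanism.sellerGets c v)
      =ᵐ[uniform01.law] (Set.Ici ((3 + c) / 4)).indicator
        fun v => (3 + c) / 4 - (4 * v - 3) := by
    filter_upwards [uniform01.ae_mem_types] with v hv
    have hv1 : v ≤ 1 := hv.2
    simp only [thresholdMechanism, mem_thresholdRegion, Set.indicator_apply,
      Set.mem_Ici]
    split_ifs <;> grind
  rw [integral_congr_ae hae, integral_uniform01_indicator_Ici _ (by linarith),
    integral_Icc_eq_integral_Ioc, ← intervalIntegral.integral_of_le (by linarith),
    intervalIntegral.integral_eq_sub_of_hasDerivAt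
      (f := fun v => (3 + c) / 4 * v - (2 * v ^ 2 - 3 * v)) (fun v _ => ?_)
      (Continuous.intervalIntegrable (by fun_prop) _ _)]
  · ring
  · refine (((hasDerivAt_id v).const_mul _).sub ((((hasDerivAt_id v).pow 2).const_mul 2).sub
      ((hasDerivAt_id v).const_mul 3))).congr_deriv ?_
    simp
    ring

theorem revenue_eq (hG : G.ub ≤ 1) :
    thresholdMechanism.revenue uniform01 G = ∫ c, (1 - c) ^ 2 / 16 ∂G.law := by
  have hI : Integrable (fun z : ℝ × ℝ =>
      thresholdMechanism.buyerPays z.1 z.2 - thresholdMechanism.sellerGets z.1 z.2)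
      (G.law.prod uniform01.law) := finitePayments.1.sub finitePayments.2.1
  rw [DirectMechanism.revenue, integral_prod _ hI]
  refine integral_congr_ae ?_
  filter_upwards [G.ae_mem_types] with c hc
  exact integral_revenue hc.1 (hc.2.trans hG)

end thresholdMechanism

/-! ### Optimal revenue against affine fees for the cubic seller. -/

section cubicPrior

variable {s : ℝ} (hs : 0 < s) (hs1 : s < 1)

theorem le_optRevenue_cubicPrior :
    s ^ 2 / (1 - s ^ 2) * (-Real.log s / 8) ≤ optRevenue uniform01 (cubicPrior s hs hs1) := by
  have hub : (cubicPrior s hs hs1).ub ≤ 1 := by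
    change 1 - s ≤ 1
    linarith
  refine le_csSup (bddAbove_mechanismRevenues_uniform01 _) ⟨thresholdMechanism,
    thresholdMechanism.finitePayments, thresholdMechanism.bic le_rfl,
    thresholdMechanism.interimIR, ?_⟩
  rw [thresholdMechanism.revenue_eq hub, integral_cubicPrior, integral_cubicDensity_mul_sq hs hs1]

/-- Below `t` the integrand is that of `integral_cubicDensity_mul_sub`, and above `t` it vanishes.
If `t > 1 - s`, continuing the density formula up to `t` only adds a nonnegative amount. -/
theorem integral_cubicPrior_max_le {t : ℝ} (ht0 : 0 ≤ t) (ht1 : t < 1) :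
    ∫ c, max (t - c) 0 ∂(cubicPrior s hs hs1).law
      ≤ s ^ 2 / (1 - s ^ 2) * (t ^ 2 / (1 - t)) := by
  rw [integral_cubicPrior, ← integral_cubicDensity_mul_sub hs hs1 ht0 ht1,
    intervalIntegral.integral_of_le (by linarith), intervalIntegral.integral_of_le ht0]
  have hcont : ContinuousOn (fun x => cubicDensity s x * (t - x)) (Set.Icc 0 t) :=
    ((continuousOn_cubicDensity hs hs1).mono fun x hx => hx.2.trans_lt ht1).mul (by fun_prop)
  have hInt : IntegrableOn (fun x => cubicDensity s x * (t - x)) (Set.Ioc 0 t) :=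
    hcont.integrableOn_Icc.mono_set Set.Ioc_subset_Icc_self
  rw [← integral_indicator measurableSet_Ioc, ← integral_indicator measurableSet_Ioc]
  refine integral_mono_of_nonneg (.of_forall fun x => ?_)
    (hInt.integrable_indicator measurableSet_Ioc) (.of_forall fun x => ?_)
  · refine Set.indicator_nonneg (fun x hx => ?_) x
    exact mul_nonneg (cubicDensity_pos hs hs1 (by linarith [hx.2])).le (le_max_right _ _)
  · by_cases hx : x ∈ Set.Ioc 0 (1 - s)
    · by_cases hxt : x ≤ t
      · have hx' : x ∈ Set.Ioc 0 t := ⟨hx.1, hxt⟩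
        simp only [Set.indicator_of_mem hx, Set.indicator_of_mem hx',
          max_eq_left (sub_nonneg.2 hxt), le_refl]
      · have hx' : x ∉ Set.Ioc 0 t := fun h => hxt h.2
        simp only [Set.indicator_of_mem hx, Set.indicator_of_notMem hx',
          max_eq_right (sub_nonpos.2 (not_le.1 hxt).le), mul_zero, le_refl]
    · simp only [Set.indicator_of_notMem hx]
      refine Set.indicator_nonneg (fun x hx => ?_) x
      exact mul_nonneg (cubicDensity_pos hs hs1 (hx.2.trans_lt ht1)).le (sub_nonneg.2 hx.2)

theorem feeRevenue_cubicPrior_le {α β : ℝ} {P : ℝ → ℝ} (hα : 0 ≤ α) (hα1 : α ≤ 1) (hβ : 0 ≤ β)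
    (hP : IsFeeEquilibrium uniform01 (cubicPrior s hs hs1) (affineFee α β) P) :
    feeRevenue uniform01 (cubicPrior s hs hs1) (affineFee α β) P
      ≤ s ^ 2 / (2 * (1 - s ^ 2)) := by
  have h3 : 0 < 1 - s ^ 2 := by nlinarith
  have hbound : 0 ≤ s ^ 2 / (2 * (1 - s ^ 2)) := by positivity
  set G := cubicPrior s hs hs1 with hG
  rw [feeRevenue_uniform01 _ fun c hc => (hP.2 c hc).1]
  have hpt : ∀ᵐ c ∂G.law,
      affineFee α β (P c) * max (1 - P c) 0
        ≤ (1 - (α - β)) * max (α - β - c) 0 / (2 * (α - β)) ∨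
      affineFee α β (P c) * max (1 - P c) 0 = 0 := by
    -- Cost `0`, where the pointwise bound can fail, is a null event.
    filter_upwards [G.ae_mem_types, G.ae_ne 0] with c hc hc0
    obtain ⟨h0, hopt⟩ := hP.2 c hc
    refine affineFee_revenue_le hα hα1 hβ (lt_of_le_of_ne hc.1 (Ne.symm hc0)) h0 fun q hq => ?_
    have h := hopt q hq
    rwa [feeSellerUtility_uniform01 _ _ hq, feeSellerUtility_uniform01 _ _ h0] at h
  have hnn : 0 ≤ᵐ[G.law] fun c => affineFee α β (P c) * max (1 - P c) 0 := by
    filter_upwards [G.ae_mem_types] with c hc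
    have h0 := (hP.2 c hc).1
    have h1 : 0 ≤ 1 - α := by linarith
    have : 0 ≤ affineFee α β (P c) := add_nonneg (mul_nonneg h1 h0) hβ
    exact mul_nonneg this (le_max_right _ _)
  obtain ⟨t, ht⟩ : ∃ t, t = α - β := ⟨_, rfl⟩
  rw [← ht] at hpt
  -- In these cases the pointwise bound is zero: nobody has cost below `t`, or the fee vanishes at
  -- price `1`. Otherwise `t` and `1 - t` can be cancelled.
  by_cases hdeg : t ≤ 0 ∨ t = 1
  · have hz : ∀ᵐ c ∂G.law, affineFee α β (P c) * max (1 - P c) 0 ≤ 0 := by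
      filter_upwards [hpt, G.ae_mem_types] with c h hc
      rcases h with h | h
      · refine h.trans (le_of_eq ?_)
        rcases hdeg with h' | h'
        · rw [max_eq_right (by linarith [hc.1]), mul_zero, zero_div]
        · rw [h', sub_self, zero_mul, zero_div]
      · exact h.le
    exact (integral_nonpos_of_ae hz).trans hbound
  push Not at hdeg
  obtain ⟨ht0, htne⟩ := hdeg
  have ht1 : t < 1 := lt_of_le_of_ne (by linarith) htne
  have hK : 0 ≤ (1 - t) / (2 * t) := div_nonneg (by linarith) (by linarith)
  have hmax : Integrable (fun c => max (t - c) 0) G.law := by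
    refine Integrable.of_bound (by fun_prop) 1 ?_
    filter_upwards [G.ae_mem_types] with c hc
    rw [Real.norm_of_nonneg (le_max_right _ _)]
    exact max_le (by linarith [hc.1]) zero_le_one
  calc ∫ c, affineFee α β (P c) * max (1 - P c) 0 ∂G.law
      ≤ ∫ c, (1 - t) / (2 * t) * max (t - c) 0 ∂G.law := by
        refine integral_mono_of_nonneg hnn (hmax.const_mul _) ?_
        filter_upwards [hpt] with c h
        rcases h with h | h
        · exact h.trans (le_of_eq (by ring))
        · rw [h]
          exact mul_nonneg hK (le_max_right _ _)
    _ = (1 - t) / (2 * t) * ∫ c, max (t - c) 0 ∂G.law := integral_const_mul _ _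
    _ ≤ (1 - t) / (2 * t) * (s ^ 2 / (1 - s ^ 2) * (t ^ 2 / (1 - t))) :=
        mul_le_mul_of_nonneg_left (integral_cubicPrior_max_le hs hs1 ht0.le ht1) hK
    _ = s ^ 2 / (2 * (1 - s ^ 2)) * t := by
        have : 1 - t ≠ 0 := by linarith
        field_simp
    _ ≤ s ^ 2 / (2 * (1 - s ^ 2)) := mul_le_of_le_one_right hbound ht1.le

theorem mem_upperBounds_properRevenues_cubicPrior :
    s ^ 2 / (2 * (1 - s ^ 2)) ∈ upperBounds (properRevenues uniform01 (cubicPrior s hs hs1)) := by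
  rintro r ⟨α, β, P, hα, hα1, hβ, hP, rfl⟩
  exact feeRevenue_cubicPrior_le hs hs1 hα hα1 hβ hP

end cubicPrior

/-! ### Positivity of the best proper revenue. -/

/-- Against the fee `p / 2` and a uniform buyer, a seller of cost `c` asks `min (1 / 2 + c) 1`. -/
theorem isFeeEquilibrium_half (G : Prior) :
    IsFeeEquilibrium uniform01 G (affineFee (1 / 2) 0) fun c => min (1 / 2 + c) 1 := by
  refine ⟨by fun_prop, fun c hc => ?_⟩
  have hc0 : 0 ≤ c := hc.1
  have h0 : 0 ≤ min (1 / 2 + c) 1 := le_min (by linarith) zero_le_one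
  refine ⟨h0, fun p hp => ?_⟩
  rw [feeSellerUtility_uniform01 _ _ hp, feeSellerUtility_uniform01 _ _ h0]
  unfold affineFee
  rcases le_total (1 / 2 + c) 1 with h | h
  · rw [min_eq_left h, max_eq_left (by linarith : (0 : ℝ) ≤ 1 - (1 / 2 + c))]
    rcases le_total p 1 with hp1 | hp1
    · rw [max_eq_left (by linarith)]
      nlinarith [sq_nonneg (p - (1 / 2 + c))]
    · rw [max_eq_right (by linarith)]
      nlinarith [sq_nonneg (1 - 2 * c)]
  · rw [min_eq_right h, sub_self, max_self, mul_zero]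
    rcases le_total p 1 with hp1 | hp1
    · rw [max_eq_left (by linarith)]
      exact mul_nonpos_of_nonpos_of_nonneg (by linarith) (by linarith)
    · rw [max_eq_right (by linarith), mul_zero]

theorem feeRevenue_half_pos (G : Prior) :
    0 < feeRevenue uniform01 G (affineFee (1 / 2) 0) fun c => min (1 / 2 + c) 1 := by
  rw [feeRevenue_uniform01 _ fun c hc => ((isFeeEquilibrium_half G).2 c hc).1, G.integral_law]
  have hP : ∀ c : ℝ, 0 ≤ c → 0 < min (1 / 2 + c) 1 :=
    fun c hc => lt_min (by linarith) one_pos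
  have hint : Integrable fun c => G.pdf c *
      (affineFee (1 / 2) 0 (min (1 / 2 + c) 1) * max (1 - min (1 / 2 + c) 1) 0) := by
    have hmeas : Measurable fun c : ℝ =>
        affineFee (1 / 2) 0 (min (1 / 2 + c) 1) * max (1 - min (1 / 2 + c) 1) 0 := by
      unfold affineFee
      fun_prop
    have hpdf := G.measurable_pdf
    refine G.integrable_pdf.mono' (by fun_prop) ?_
    filter_upwards with c
    by_cases hc : c ∈ Set.Icc 0 G.ub
    · have h1 := hP c hc.1
      have h2 : min (1 / 2 + c) 1 ≤ 1 := min_le_right _ _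
      have h3 : 0 ≤ max (1 - min (1 / 2 + c) 1) 0 := le_max_right _ _
      have h4 : max (1 - min (1 / 2 + c) 1) 0 ≤ 1 := max_le (by linarith) zero_le_one
      have h5 : 0 ≤ affineFee (1 / 2) 0 (min (1 / 2 + c) 1) := by
        unfold affineFee
        positivity
      have h6 : affineFee (1 / 2) 0 (min (1 / 2 + c) 1) ≤ 1 := by
        unfold affineFee
        linarith
      have h7 := G.pdf_nonneg c
      rw [Real.norm_of_nonneg (by positivity)]
      exact mul_le_of_le_one_right h7 (mul_le_one₀ h6 h3 h4)
    · simp [G.pdf_zero c hc]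
  have hub := G.ub_pos
  -- Costs below `1 / 2` are those whose price stays below `1`, so that trade has positive
  -- probability.
  have hm : 0 < min G.ub (1 / 2) := lt_min hub (by norm_num)
  refine lt_of_lt_of_le (b := ∫ c in (0 : ℝ)..min G.ub (1 / 2), G.pdf c *
    (affineFee (1 / 2) 0 (min (1 / 2 + c) 1) * max (1 - min (1 / 2 + c) 1) 0)) ?_ ?_
  · refine intervalIntegral.intervalIntegral_pos_of_pos_on hint.intervalIntegrable
      (fun c hc => ?_) hm
    obtain ⟨hc0, hc1⟩ := hc
    have hcu := (lt_min_iff.1 hc1).1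
    have hch := (lt_min_iff.1 hc1).2
    have h1 := hP c hc0.le
    have h2 : 0 < 1 - min (1 / 2 + c) 1 := by
      rw [min_eq_left (by linarith)]
      linarith
    have h3 := G.pdf_pos c ⟨hc0.le, hcu.le⟩
    have h4 : 0 < max (1 - min (1 / 2 + c) 1) 0 := lt_max_of_lt_left h2
    unfold affineFee
    positivity
  · refine intervalIntegral.integral_mono_interval le_rfl hm.le (min_le_left _ _) ?_
      hint.intervalIntegrable
    filter_upwards [ae_restrict_mem measurableSet_Ioc] with c hc
    have h1 := hP c hc.1.le
    have h3 := G.pdf_nonneg c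
    unfold affineFee
    simp only [Pi.zero_apply]
    positivity

end

/-- The first conjuncts say that the seller is drawn from the explicit regular family; the next
three say that both suprema in the ratio are finite and that its denominator is positive. -/
theorem theorem3 (d : ℝ) :
    ∃ (δ : ℝ) (G : Prior), 0 < δ ∧ δ < 1 ∧ G.ub = 1 - √δ ∧
      (∀ x ∈ Set.Icc 0 (1 - √δ), G.pdf x = 2 * δ / ((1 - δ) * (1 - x) ^ 3)) ∧
      G.SellerRegular ∧
      BddAbove (mechanismRevenues uniform01 G) ∧
      BddAbove (properRevenues uniform01 G) ∧
      0 < bestProperRevenue uniform01 G ∧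
      d ≤ revenueGap uniform01 G := by
  -- Chosen so that `-log s / 4 = max d 1`; the maximum with `1` ensures `s < 1` and a nonnegative
  -- multiplier.
  obtain ⟨s, hsd⟩ : ∃ s, s = Real.exp (-(4 * max d 1)) := ⟨_, rfl⟩
  have hs : 0 < s := hsd ▸ Real.exp_pos _
  have hd1 : 1 ≤ max d 1 := le_max_right _ _
  have hs1 : s < 1 := by
    rw [hsd, Real.exp_lt_one_iff]
    linarith
  have hlog : Real.log s = -(4 * max d 1) := by rw [hsd, Real.log_exp]
  have hsq : √(s ^ 2) = s := Real.sqrt_sq hs.le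
  have h3 : 0 < 1 - s ^ 2 := by nlinarith
  have hub := mem_upperBounds_properRevenues_cubicPrior hs hs1
  have hpos : 0 < bestProperRevenue uniform01 (cubicPrior s hs hs1) :=
    (feeRevenue_half_pos _).trans_le (le_csSup ⟨_, hub⟩ ⟨1 / 2, 0, _, by norm_num, by norm_num,
      le_rfl, isFeeEquilibrium_half _, rfl⟩)
  have hle : bestProperRevenue uniform01 (cubicPrior s hs hs1) ≤ s ^ 2 / (2 * (1 - s ^ 2)) :=
    csSup_le ⟨_, 1 / 2, 0, _, by norm_num, by norm_num, le_rfl, isFeeEquilibrium_half _, rfl⟩ hub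
  refine ⟨s ^ 2, cubicPrior s hs hs1, by positivity, by linarith, ?_, ?_,
    sellerRegular_cubicPrior hs hs1, bddAbove_mechanismRevenues_uniform01 _, ⟨_, hub⟩, hpos, ?_⟩
  · rw [hsq]
    rfl
  · rw [hsq]
    exact fun x hx => cubicPrior_pdf hs hs1 hx
  · rw [revenueGap, le_div_iff₀ hpos]
    calc d * bestProperRevenue uniform01 (cubicPrior s hs hs1)
        ≤ max d 1 * (s ^ 2 / (2 * (1 - s ^ 2))) :=
          mul_le_mul (le_max_left _ _) hle hpos.le (by linarith)
      _ = s ^ 2 / (1 - s ^ 2) * (-Real.log s / 8) := by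
          rw [hlog]
          field_simp
          ring
      _ ≤ _ := le_optRevenue_cubicPrior hs hs1
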